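/- Let $M_1(1)=\mathbb C[x_1,x_2,\dots]$ be the rank one Heisenberg vertex algebra with vacuum $\mathbf 1=1$. The operators $\alpha(n)$, $n\in\mathbb Z$, act by $\alpha(-m)=x_m\cdot$, $\alpha(0)=0$, $\alpha(m)=m\,\partial/\partial x_m$ for $m\ge1$, so that $[\alpha(m),\alpha(n)]=m\,\delta_{m+n,0}$. The vertex operator $Y(v,z)=\sum_{n\in\mathbb Z}v(n)z^{-n-1}$ of $v=\alpha(-m_1)\cdots\alpha(-m_d)\mathbf 1$ is the normally ordered product of the fields $\frac1{(m_i-1)!}\left(\frac{d}{dz}\right)^{m_i-1}\alpha(z)$, where $\alpha(z)=\sum_{n}\alpha(n)z^{-n-1}$, and $Y$ is extended linearly. For $d\ge 0$ let $M_1^d(1)$ be the span of all vectors $\alpha(-m_1)\cdots\alpha(-m_d)\mathbf 1$ with $m_i\ge1$ (the vectors of $\alpha$-length $d$). For a subspace $M$ of a vertex algebra $V$ with vacuum $\mathbf 1$, the radical $\mathfrak r(M)$ is the set of $v\in V$ for which there is $m\ge1$ with $v(n_1)\cdots v(n_t)\mathbf 1\in M$ for all $t\ge m$ and all $n_1,\dots,n_t\in\mathbb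 Z$. The strong radical $\mathfrak{sr}(M)$ is the set of $v\in V$ for which there is $m\ge1$ with $b(s)\,v(n_1)\cdots v(n_t)\mathbf 1\in M$ and $\big(v(n_1)\cdots v(n_t)\mathbf 1\big)(s)\,b\in M$ for all $t\ge m$, $b\in V$ and $s,n_1,\dots,n_t\in\mathbb Z$. The subspace $M$ is a Mathieu-Zhao subspace of $V$ if $\mathfrak r(M)=\mathfrak{sr}(M)$. It is an ideal if $v(n)u\in M$ and $u(n)v\in M$ for all $u\in V$, $v\in M$, $n\in\mathbb Z$. Let $k>1$, and let $g$ be the linear automorphism of $M_1(1)$ that acts on $M_1^d(1)$ as multiplication by $e^{2\pi i d/k}$ for every $d\ge0$. Then $g$ has order $k$, its eigenspace for the eigenvalue $e^{2\pi i l/k}$ $(0\le l\le k-1)$ is $$M_1^{(l)}(1)=\bigoplus_{d\ge 0,\ d\equiv l\ (\mathrm{mod}\ k)}M_1^d(1),\qquad\text{and}\qquad M_1(1)=\bigoplus_{l=0}^{k-1}M_1^{(l)}(1).$$ For every set $\{l_1,\dots,l_s\}$ of distinct integers with $1\le l_r\le k-1$, the subspace $$M=\bigoplus_{r=1}^sM_1^{(l_r)}(1)$$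 is a Mathieu-Zhao subspace of $M_1(1)$, and if $s\ge1$ then $M$ is not an ideal of $M_1(1)$. As $k>1$ and $\{l_1,\dots,l_s\}$ vary, infinitely many different non-ideal Mathieu-Zhao subspaces of $M_1(1)$ of this form arise. -/

import Mathlib

noncomputable section

namespace MZVertex

/-! ### Modes, ideals and Mathieu-Zhao subspaces

The state-field correspondence is a linear map `Y` from `V` to `VertexOperator ℂ V`
(linear maps `V → V((z))`), and `vac` is the vacuum vector. -/

section General

variable {V : Type*} [AddCommGroup V] [Module ℂ V]

/-- The mode `v(n)`, where `Y(v,z) = ∑ v(n) z^(-n-1)`. -/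
def mode (Y : V →ₗ[ℂ] VertexOperator ℂ V) (v : V) (n : ℤ) : Module.End ℂ V :=
  VertexOperator.ncoeff (Y v) n

/-- `v(n₁) ⋯ v(nₜ) 1` for the list `[n₁, …, nₜ]`. -/
def iterMode (Y : V →ₗ[ℂ] VertexOperator ℂ V) (vac v : V) (ns : List ℤ) : V :=
  (ns.map (mode Y v)).prod vac

/-- Two-sided ideals of a vertex algebra. -/
def IsVertexIdeal (Y : V →ₗ[ℂ] VertexOperator ℂ V) (I : Submodule ℂ V) : Prop :=
  ∀ u : V, ∀ v ∈ I, ∀ n : ℤ, mode Y v n u ∈ I ∧ mode Y u n v ∈ I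

/-- The radical of a subspace. -/
def radical (Y : V →ₗ[ℂ] VertexOperator ℂ V) (vac : V) (M : Submodule ℂ V) : Set V :=
  {v | ∃ m : ℕ, 1 ≤ m ∧ ∀ ns : List ℤ, m ≤ ns.length → iterMode Y vac v ns ∈ M}

/-- The left strong radical of a subspace. -/
def leftStrongRadical (Y : V →ₗ[ℂ] VertexOperator ℂ V) (vac : V) (M : Submodule ℂ V) : Set V :=
  {v | ∃ m : ℕ, 1 ≤ m ∧ ∀ ns : List ℤ, m ≤ ns.length →
    ∀ (b : V) (s : ℤ), mode Y b s (iterMode Y vac v ns) ∈ M}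

/-- The right strong radical of a subspace. -/
def rightStrongRadical (Y : V →ₗ[ℂ] VertexOperator ℂ V) (vac : V) (M : Submodule ℂ V) : Set V :=
  {v | ∃ m : ℕ, 1 ≤ m ∧ ∀ ns : List ℤ, m ≤ ns.length →
    ∀ (w : V) (n : ℤ), mode Y (iterMode Y vac v ns) n w ∈ M}

/-- The strong radical of a subspace. -/
def strongRadical (Y : V →ₗ[ℂ] VertexOperator ℂ V) (vac : V) (M : Submodule ℂ V) : Set V :=
  leftStrongRadical Y vac M ∩ rightStrongRadical Y vac M

/-- Mathieu-Zhao subspaces of a vertex algebra. -/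
def IsMathieuZhao (Y : V →ₗ[ℂ] VertexOperator ℂ V) (vac : V) (M : Submodule ℂ V) : Prop :=
  radical Y vac M = strongRadical Y vac M

end General

/-! ### The rank one Heisenberg module -/

/-- The underlying space of `M₁(1)`: the Fock space `ℂ[x₁, x₂, …]` with vacuum `1`. The theorem
`fock_universal` below identifies it with the module over the Heisenberg algebra that is induced
from the trivial module of `h ⊗ ℂ[t] ⊕ ℂ c`, with `c` acting as `1`. -/
abbrev Fock : Type := MvPolynomial ℕ+ ℂ

/-- The operator `α(n)`, for `⟨α, α⟩ = 1`: `α(-m)` is multiplication by `x_m`, `α(0) = 0`, and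
`α(m) = m ∂/∂x_m`, for `m ≥ 1`. -/
def alpha : ℤ → Module.End ℂ Fock
  | Int.negSucc m => LinearMap.mulLeft ℂ (MvPolynomial.X m.succPNat)
  | Int.ofNat 0 => 0
  | Int.ofNat (m + 1) => ((m : ℂ) + 1) • (MvPolynomial.pderiv (R := ℂ) m.succPNat).toLinearMap

/-- The vector `α(-n₁) ⋯ α(-n_d) 1` for the list `[n₁, …, n_d]` of positive integers. -/
def alphaVec (L : List ℕ+) : Fock := (L.map fun m : ℕ+ => alpha (-(m : ℤ))).prod 1

theorem alpha_neg (m : ℕ+) (v : Fock) : alpha (-(m : ℤ)) v = MvPolynomial.X m * v := by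
  obtain ⟨k, rfl⟩ : ∃ k : ℕ, m = k.succPNat := ⟨m.natPred, by simp⟩
  have : (-((k.succPNat : ℕ+) : ℤ)) = Int.negSucc k := by
    simp [Int.negSucc_eq]
  rw [this]; rfl

theorem alpha_zero : alpha 0 = 0 := rfl

theorem alpha_pos (m : ℕ+) (v : Fock) :
    alpha (m : ℤ) v = (m : ℂ) • MvPolynomial.pderiv m v := by
  obtain ⟨k, rfl⟩ : ∃ k : ℕ, m = k.succPNat := ⟨m.natPred, by simp⟩
  have : (((k.succPNat : ℕ+) : ℕ) : ℤ) = Int.ofNat (k + 1) := by simp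
  rw [this]; simp [alpha]

theorem int_cases (n : ℤ) : (∃ m : ℕ+, n = -(m : ℤ)) ∨ n = 0 ∨ ∃ m : ℕ+, n = (m : ℤ) := by
  rcases lt_trichotomy n 0 with h | h | h
  · exact Or.inl ⟨⟨n.natAbs, by omega⟩, by rw [PNat.mk_coe]; omega⟩
  · exact Or.inr (Or.inl h)
  · exact Or.inr (Or.inr ⟨⟨n.natAbs, by omega⟩, by rw [PNat.mk_coe]; omega⟩)

theorem alphaVec_eq (L : List ℕ+) : alphaVec L = (L.map MvPolynomial.X).prod := by
  induction L with
  | nil => simp [alphaVec]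
  | cons a L ih =>
    simp only [alphaVec, List.map_cons, List.prod_cons, Module.End.mul_apply] at ih ⊢
    rw [ih, alpha_neg]

theorem monomial_eq_alphaVec (d : ℕ+ →₀ ℕ) :
    MvPolynomial.monomial d (1 : ℂ) = alphaVec (Finsupp.toMultiset d).toList := by
  rw [alphaVec_eq, ← Multiset.prod_coe, ← Multiset.map_coe, Multiset.coe_toList,
    Finsupp.toMultiset_map, Finsupp.prod_toMultiset, Finsupp.prod_mapDomain_index]
  · rw [MvPolynomial.monomial_eq]; simp
  · simp
  · intro a b c; exact pow_add _ _ _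

theorem pderiv_comm (a b : ℕ+) (v : Fock) : MvPolynomial.pderiv a (MvPolynomial.pderiv b v) =
    MvPolynomial.pderiv b (MvPolynomial.pderiv a v) := by
  have h : ⁅MvPolynomial.pderiv (R := ℂ) a, MvPolynomial.pderiv (R := ℂ) b⁆ = 0 := by
    apply MvPolynomial.derivation_ext
    intro i
    rw [Derivation.commutator_apply, MvPolynomial.pderiv_X, MvPolynomial.pderiv_X]
    simp only [Pi.single_apply]
    split_ifs <;> simp
  have h' := congrArg (fun D => D v) h
  simp only [Derivation.commutator_apply, Derivation.coe_zero, Pi.zero_apply] at h'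
  exact sub_eq_zero.mp h'

/-- The Heisenberg commutation relations. -/
theorem alpha_comm (m n : ℤ) (v : Fock) :
    alpha m (alpha n v) = alpha n (alpha m v) + (if m + n = 0 then (m : ℂ) else 0) • v := by
  rcases int_cases m with ⟨a, rfl⟩ | rfl | ⟨a, rfl⟩ <;>
  rcases int_cases n with ⟨b, rfl⟩ | rfl | ⟨b, rfl⟩
  · have ha := a.pos
    have hb := b.pos
    rw [if_neg (by omega)]
    simp only [alpha_neg]; simp; ring
  · simp [alpha_zero]
  · simp only [alpha_neg, alpha_pos, Derivation.leibniz, MvPolynomial.pderiv_X, smul_eq_mul]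
    by_cases h : a = b
    · subst h
      simp [MvPolynomial.smul_eq_C_mul]; ring
    · have h' : (a : ℤ) ≠ b := by exact_mod_cast fun h' => h (PNat.eq h')
      rw [if_neg (by omega), Pi.single_eq_of_ne h]
      simp [MvPolynomial.smul_eq_C_mul]; ring
  · simp [alpha_zero]
  · simp [alpha_zero]
  · simp [alpha_zero]
  · simp only [alpha_neg, alpha_pos, Derivation.leibniz, MvPolynomial.pderiv_X, smul_eq_mul]
    by_cases h : b = a
    · subst h
      simp [MvPolynomial.smul_eq_C_mul]; ring
    · have h' : (b : ℤ) ≠ a := by exact_mod_cast fun h' => h (PNat.eq h')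
      rw [if_neg (by omega), Pi.single_eq_of_ne h]
      simp [MvPolynomial.smul_eq_C_mul]; ring
  · simp [alpha_zero]
  · have ha := a.pos
    have hb := b.pos
    rw [if_neg (by omega)]
    rw [zero_smul, add_zero, alpha_pos a, alpha_pos b, alpha_pos b, alpha_pos a,
      Derivation.map_smul, Derivation.map_smul, smul_comm, pderiv_comm]

theorem alpha_vac {n : ℤ} (hn : 0 ≤ n) : alpha n (1 : Fock) = 0 := by
  rcases int_cases n with ⟨b, rfl⟩ | rfl | ⟨b, rfl⟩
  · have := b.pos
    omega
  · simp [alpha_zero]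
  · simp [alpha_pos]

theorem fock_induction {p : Fock → Prop} (h1 : p 1) (hadd : ∀ u v, p u → p v → p (u + v))
    (hsmul : ∀ (c : ℂ) u, p u → p (c • u))
    (halpha : ∀ (m : ℕ+) u, p u → p (alpha (-(m : ℤ)) u)) (v : Fock) : p v := by
  induction v using MvPolynomial.induction_on with
  | C a => simpa [MvPolynomial.smul_eq_C_mul] using hsmul a 1 h1
  | add u v hu hv => exact hadd u v hu hv
  | mul_X u i hu => rw [mul_comm, ← alpha_neg]; exact halpha i u hu

open scoped IsMulCommutative in
/-- The universal property of the induced module: a module of level `1` over the Heisenberg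
algebra, with a vector `w` killed by all `α(n)`, `n ≥ 0`, receives exactly one homomorphism from
the Fock space that maps the vacuum to `w`. -/
theorem fock_universal {W : Type*} [AddCommGroup W] [Module ℂ W] (a : ℤ → Module.End ℂ W)
    (ha : ∀ m n w, a m (a n w) = a n (a m w) + (if m + n = 0 then (m : ℂ) else 0) • w)
    (w : W) (hw : ∀ n, 0 ≤ n → a n w = 0) :
    ∃! f : Fock →ₗ[ℂ] W, f 1 = w ∧ ∀ n v, f (alpha n v) = a n (f v) := by
  let s : Set (Module.End ℂ W) := Set.range fun m : ℕ+ => a (-(m : ℤ))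
  have hs : ∀ x ∈ s, ∀ y ∈ s, x * y = y * x := by
    rintro _ ⟨m, rfl⟩ _ ⟨n, rfl⟩
    ext v
    have hm := m.pos
    have hn := n.pos
    have := ha (-(m : ℤ)) (-(n : ℤ)) v
    rw [if_neg (by omega), zero_smul, add_zero] at this
    exact this
  have hcomm : IsMulCommutative (Algebra.adjoin ℂ s) := Algebra.isMulCommutative_adjoin ℂ hs
  let b : ℕ+ → Algebra.adjoin ℂ s := fun m => ⟨a (-(m : ℤ)), Algebra.subset_adjoin ⟨m, rfl⟩⟩
  let F : Fock →ₐ[ℂ] Algebra.adjoin ℂ s := MvPolynomial.aeval (R := ℂ) b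
  let f : Fock →ₗ[ℂ] W :=
    (LinearMap.applyₗ w).comp ((Algebra.adjoin ℂ s).val.toLinearMap.comp F.toLinearMap)
  have hf1 : f 1 = w := by simp [f]
  have hfneg : ∀ (m : ℕ+) v, f (alpha (-(m : ℤ)) v) = a (-(m : ℤ)) (f v) := by
    intro m v
    simp [f, alpha_neg, F, b]
  have hfnn : ∀ (v : Fock) (n : ℤ), 0 ≤ n → f (alpha n v) = a n (f v) := by
    intro v
    induction v using fock_induction with
    | h1 => intro n hn; rw [alpha_vac hn, hf1, hw n hn, map_zero]
    | hadd u v hu hv => intro n hn; simp only [map_add, hu n hn, hv n hn]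
    | hsmul c u hu => intro n hn; simp only [map_smul, hu n hn]
    | halpha m u hu =>
      intro n hn
      rw [alpha_comm, hfneg, ha, map_add, map_smul, hfneg, hu n hn]
  refine ⟨f, ⟨hf1, fun n v => ?_⟩, ?_⟩
  · rcases int_cases n with ⟨m, rfl⟩ | rfl | ⟨m, rfl⟩
    · exact hfneg m v
    · exact hfnn v 0 le_rfl
    · exact hfnn v _ (by positivity)
  · rintro g ⟨hg1, hg⟩
    refine LinearMap.ext fun v => ?_
    induction v using fock_induction with
    | h1 => rw [hg1, hf1]
    | hadd u v hu hv => rw [map_add, map_add, hu, hv]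
    | hsmul c u hu => rw [map_smul, map_smul, hu]
    | halpha m u hu => rw [hg, hfneg, hu]

/-! ### The vertex operators of the Heisenberg module -/

/-- The coefficient of `α(j) z^(-j-m)` in `(1/(m-1)!) (d/dz)^(m-1) α(z)`, where
`α(z) = ∑ α(j) z^(-j-1)`. -/
def fieldCoeff (m : ℕ+) (j : ℤ) : ℂ := (Ring.choose (-j - 1) (m.natPred) : ℤ)

/-- The normally ordered product of `α(j₁), …, α(j_k)`: all `α(j)` with `j < 0` stand to the left
of all `α(j)` with `j ≥ 0`. -/
def normalOrd (js : List ℤ) : Module.End ℂ Fock :=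
  ((js.filter (· < 0)).map alpha).prod * ((js.filter (0 ≤ ·)).map alpha).prod

theorem exists_alpha_bound (w : Fock) : ∃ N : ℤ, 0 ≤ N ∧ ∀ n, N < n → alpha n w = 0 := by
  induction w using fock_induction with
  | h1 => exact ⟨0, le_rfl, fun n hn => alpha_vac hn.le⟩
  | hadd u v hu hv =>
    obtain ⟨N, hN, hu⟩ := hu
    obtain ⟨M, hM, hv⟩ := hv
    exact ⟨max N M, by omega, fun n hn => by
      rw [map_add, hu n (by omega), hv n (by omega), add_zero]⟩
  | hsmul c u hu =>
    obtain ⟨N, hN, hu⟩ := hu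
    exact ⟨N, hN, fun n hn => by rw [map_smul, hu n hn, smul_zero]⟩
  | halpha m u hu =>
    obtain ⟨N, hN, hu⟩ := hu
    exact ⟨max N m, by omega, fun n hn => by
      rw [alpha_comm, hu n (by omega), map_zero, if_neg (by omega), zero_smul, add_zero]⟩

theorem alpha_prod_comm (a : ℤ) (ha : 0 ≤ a) (l : List ℤ) (hl : ∀ b ∈ l, 0 ≤ b) (w : Fock) :
    alpha a ((l.map alpha).prod w) = (l.map alpha).prod (alpha a w) := by
  induction l with
  | nil => rfl
  | cons b l ih =>
    rw [List.map_cons, List.prod_cons, Module.End.mul_apply, Module.End.mul_apply, alpha_comm,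
      ih fun c hc => hl c (List.mem_cons_of_mem _ hc)]
    have hb := hl b List.mem_cons_self
    split_ifs with h
    · rw [show a = 0 by omega]; simp
    · simp

theorem alpha_prod_kill (a : ℤ) (l : List ℤ) (hl : ∀ b ∈ l, 0 ≤ b) (hal : a ∈ l) (w : Fock)
    (hw : alpha a w = 0) : (l.map alpha).prod w = 0 := by
  induction l with
  | nil => simp at hal
  | cons b l ih =>
    rw [List.map_cons, List.prod_cons, Module.End.mul_apply]
    have hl' : ∀ c ∈ l, 0 ≤ c := fun c hc => hl c (List.mem_cons_of_mem _ hc)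
    rcases List.mem_cons.mp hal with rfl | h
    · rw [alpha_prod_comm _ (hl _ List.mem_cons_self) _ hl', hw, map_zero]
    · rw [ih hl' h, map_zero]

theorem normalOrd_kill {N : ℤ} (hN : 0 ≤ N) {w : Fock} (hw : ∀ n, N < n → alpha n w = 0)
    {js : List ℤ} {a : ℤ} (ha : a ∈ js) (haN : N < a) : normalOrd js w = 0 := by
  rw [normalOrd, Module.End.mul_apply, alpha_prod_kill a _ _ _ w (hw a haN), map_zero]
  · intro b hb
    simpa using (List.mem_filter.mp hb).2
  · exact List.mem_filter.mpr ⟨ha, by simp; omega⟩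

/-- The coefficient of `z^(-n-1)` in the normally ordered product
`∏ᵢ (1/(mᵢ-1)!) (d/dz)^(mᵢ-1) α(z)`, for the list `L = [m₁, …, m_k]`, applied to `w`. -/
def monoModeFun (L : List ℕ+) (n : ℤ) (w : Fock) : Fock :=
  ∑ᶠ j ∈ {j : Fin L.length → ℤ | ∑ i, (j i + (L.get i : ℤ)) = n + 1},
    (∏ i, fieldCoeff (L.get i) (j i)) • normalOrd (List.ofFn j) w

/-- The sum that defines `monoModeFun` has only finitely many nonzero terms. -/
theorem monoMode_finite (L : List ℕ+) (n : ℤ) (w : Fock) :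
    ({j : Fin L.length → ℤ | ∑ i, (j i + (L.get i : ℤ)) = n + 1} ∩ Function.support fun j =>
      (∏ i, fieldCoeff (L.get i) (j i)) • normalOrd (List.ofFn j) w).Finite := by
  obtain ⟨N, hN, hw⟩ := exists_alpha_bound w
  refine (Set.finite_Icc (fun _ : Fin L.length =>
    n + 1 - ∑ i, (N + (L.get i : ℤ))) (fun _ => N)).subset ?_
  rintro j ⟨hj, hsupp⟩
  have hle : ∀ i, j i ≤ N := by
    intro i
    by_contra! h
    exact hsupp (by
      simp only
      rw [normalOrd_kill hN hw ((List.mem_ofFn' _ _).mpr ⟨i, rfl⟩) h, smul_zero])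
  refine ⟨fun i => ?_, hle⟩
  have h1 : ∑ i', (j i' + (L.get i' : ℤ)) ≤ (j i - N) + ∑ i', (N + (L.get i' : ℤ)) := by
    rw [← Finset.add_sum_erase _ _ (Finset.mem_univ i),
      ← Finset.add_sum_erase _ (fun i' => N + (L.get i' : ℤ)) (Finset.mem_univ i)]
    have : ∑ i' ∈ Finset.univ.erase i, (j i' + (L.get i' : ℤ)) ≤
        ∑ i' ∈ Finset.univ.erase i, (N + (L.get i' : ℤ)) :=
      Finset.sum_le_sum fun i' _ => by have := hle i'; omega
    omega
  have hj' : ∑ i, (j i + (L.get i : ℤ)) = n + 1 := hj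
  simp only
  omega

/-- The mode `v(n)` for `v = α(-m₁) ⋯ α(-m_k) 1`, as a linear map. -/
def monoMode (L : List ℕ+) (n : ℤ) : Module.End ℂ Fock where
  toFun := monoModeFun L n
  map_add' u v := by
    unfold monoModeFun
    rw [← finsum_mem_add_distrib' (monoMode_finite L n u) (monoMode_finite L n v)]
    simp only [map_add, smul_add]
  map_smul' c u := by
    unfold monoModeFun
    rw [RingHom.id_apply, smul_finsum]
    refine finsum_congr fun j => ?_
    rw [smul_finsum]
    refine finsum_congr fun _ => ?_
    rw [map_smul, smul_comm]

/-- `v(n) w = 0` for large `n`. -/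
theorem monoMode_truncation (L : List ℕ+) (w : Fock) :
    BddBelow (Function.support fun p : ℤ => monoMode L (-p - 1) w) := by
  obtain ⟨N, hN, hw⟩ := exists_alpha_bound w
  refine ⟨-∑ i, (N + (L.get i : ℤ)), fun p hp => ?_⟩
  by_contra! hlt
  refine hp (finsum_mem_eq_zero_of_forall_eq_zero fun j hj => ?_)
  have hj' : ∑ i, (j i + (L.get i : ℤ)) = -p - 1 + 1 := hj
  obtain ⟨i, -, hi⟩ : ∃ i ∈ Finset.univ, N + (L.get i : ℤ) < j i + (L.get i : ℤ) :=
    Finset.exists_lt_of_sum_lt (by omega)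
  rw [normalOrd_kill hN hw ((List.mem_ofFn' _ _).mpr ⟨i, rfl⟩) (by omega), smul_zero]

/-- The state-field correspondence of `M₁(1)`, defined on the basis of monomials
`α(-m₁) ⋯ α(-m_k) 1` and extended linearly. -/
def fockY : Fock →ₗ[ℂ] VertexOperator ℂ Fock :=
  (MvPolynomial.basisMonomials ℕ+ ℂ).constr ℂ fun d =>
    VertexOperator.of_coeff (fun p => monoMode (Finsupp.toMultiset d).toList (-p - 1))
      (monoMode_truncation _)

theorem alpha_prod_perm_neg {l l' : List ℤ} (h : l.Perm l') (hl : ∀ b ∈ l, b < 0) :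
    (l.map alpha).prod = (l'.map alpha).prod := by
  refine (h.map alpha).prod_eq' ?_
  rw [List.pairwise_map]
  refine List.pairwise_of_forall_mem_list fun a ha b hb => ?_
  refine LinearMap.ext fun v => ?_
  have h1 := hl a ha
  have h2 := hl b hb
  have := alpha_comm a b v
  rwa [if_neg (by omega), zero_smul, add_zero] at this

theorem alpha_prod_perm_nonneg {l l' : List ℤ} (h : l.Perm l') (hl : ∀ b ∈ l, 0 ≤ b) :
    (l.map alpha).prod = (l'.map alpha).prod := by
  refine (h.map alpha).prod_eq' ?_
  rw [List.pairwise_map]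
  refine List.pairwise_of_forall_mem_list fun a ha b hb => ?_
  refine LinearMap.ext fun v => ?_
  exact alpha_prod_comm a (hl a ha) [b] (by simpa using hl b hb) v

theorem normalOrd_perm {l l' : List ℤ} (h : l.Perm l') : normalOrd l = normalOrd l' := by
  rw [normalOrd, normalOrd, alpha_prod_perm_neg (h.filter _), alpha_prod_perm_nonneg (h.filter _)]
  · intro b hb
    simpa using (List.mem_filter.mp hb).2
  · intro b hb
    simpa using (List.mem_filter.mp hb).2

theorem monoMode_perm {L L' : List ℕ+} (h : L.Perm L') (n : ℤ) : monoMode L n = monoMode L' n := by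
  obtain ⟨e, he⟩ : ∃ e : Fin L.length ≃ Fin L'.length, ∀ i, L'.get (e i) = L.get i := by
    clear n
    induction h with
    | nil => exact ⟨Equiv.refl _, fun _ => rfl⟩
    | @cons x l l' _ ih =>
      obtain ⟨e, he⟩ := ih
      refine ⟨(finSuccEquiv l.length).trans
        (e.optionCongr.trans (finSuccEquiv l'.length).symm), fun i => ?_⟩
      induction i using Fin.cases with
      | zero => simp
      | succ i => simpa using he i
    | swap x y l =>
      refine ⟨Equiv.swap (0 : Fin (l.length + 2)) 1, fun i => ?_⟩
      induction i using Fin.cases with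
      | zero => simp
      | succ i =>
        induction i using Fin.cases with
        | zero => simp
        | succ i =>
          rw [Equiv.swap_apply_of_ne_of_ne (by simp [Fin.ext_iff]) (by simp [Fin.ext_iff])]
          simp
    | trans _ _ ih1 ih2 =>
      obtain ⟨e1, h1⟩ := ih1
      obtain ⟨e2, h2⟩ := ih2
      exact ⟨e1.trans e2, fun i => by rw [Equiv.trans_apply, h2, h1]⟩
  refine LinearMap.ext fun w => ?_
  change monoModeFun L n w = monoModeFun L' n w
  unfold monoModeFun
  have hsum : ∀ j : Fin L'.length → ℤ, ∑ i, (j (e i) + (L.get i : ℤ)) =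
      ∑ i, (j i + (L'.get i : ℤ)) := fun j => by
    rw [← e.sum_comp]
    simp only [he]
  have hprod : ∀ j : Fin L'.length → ℤ, ∏ i, fieldCoeff (L.get i) (j (e i)) =
      ∏ i, fieldCoeff (L'.get i) (j i) := fun j => by
    rw [← e.prod_comp]
    simp only [he]
  have hperm : ∀ j : Fin L'.length → ℤ, (List.ofFn (j ∘ e)).Perm (List.ofFn j) := fun j => by
    rw [← Multiset.coe_eq_coe, ← Fin.univ_val_map, ← Fin.univ_val_map, ← Multiset.map_map,
      ← Multiset.map_univ_val_equiv e]
  rw [← finsum_comp_equiv (e.arrowCongr (Equiv.refl ℤ)).symm]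
  refine finsum_congr fun j => ?_
  have hj : (e.arrowCongr (Equiv.refl ℤ)).symm j = j ∘ e := rfl
  rw [hj, Set.mem_ofPred_eq, Set.mem_ofPred_eq, normalOrd_perm (hperm j)]
  simp only [Function.comp_apply, hsum, hprod]

/-- The vertex operator of `α(-m₁) ⋯ α(-m_k) 1` is the normally ordered product of the fields
`(1/(mᵢ-1)!) (d/dz)^(mᵢ-1) α(z)`, for every list of positive integers `mᵢ`. -/
theorem mode_alphaVec (L : List ℕ+) (n : ℤ) : mode fockY (alphaVec L) n = monoMode L n := by
  have h : alphaVec L =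
      MvPolynomial.basisMonomials ℕ+ ℂ (Multiset.toFinsupp (L : Multiset ℕ+)) := by
    rw [MvPolynomial.coe_basisMonomials]
    simp only
    rw [monomial_eq_alphaVec, alphaVec_eq, alphaVec_eq,
      ← Multiset.prod_coe, ← Multiset.map_coe, ← Multiset.prod_coe, ← Multiset.map_coe,
      Multiset.coe_toList, Multiset.toFinsupp_toMultiset]
  rw [h, mode, fockY, Module.Basis.constr_basis, VertexOperator.ncoeff_of_coeff]
  rw [show -(-n - 1) - 1 = n by ring]
  apply monoMode_perm
  rw [← Multiset.coe_eq_coe, Multiset.coe_toList, Multiset.toFinsupp_toMultiset]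

/-! ### The `α`-length and its rotation -/

/-- The subspace of `α`-length `d`. -/
def alphaLength (d : ℕ) : Submodule ℂ Fock :=
  Submodule.span ℂ {v | ∃ L : List ℕ+, L.length = d ∧ v = alphaVec L}

/-- The linear automorphism that multiplies `α(-m₁) ⋯ α(-m_l) 1` by `exp(2πi/k)^l`. -/
def rotation (k : ℕ) : Module.End ℂ Fock :=
  (MvPolynomial.basisMonomials ℕ+ ℂ).constr ℂ fun d =>
    Complex.exp (2 * Real.pi * Complex.I / k) ^ d.degree • MvPolynomial.monomial d 1

theorem rotation_alphaVec (k : ℕ) (L : List ℕ+) : rotation k (alphaVec L) =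
    Complex.exp (2 * Real.pi * Complex.I / k) ^ L.length • alphaVec L := by
  have h : alphaVec L =
      MvPolynomial.basisMonomials ℕ+ ℂ (Multiset.toFinsupp (L : Multiset ℕ+)) := by
    rw [MvPolynomial.coe_basisMonomials]
    simp only
    rw [monomial_eq_alphaVec, alphaVec_eq, alphaVec_eq,
      ← Multiset.prod_coe, ← Multiset.map_coe, ← Multiset.prod_coe, ← Multiset.map_coe,
      Multiset.coe_toList, Multiset.toFinsupp_toMultiset]
  have hd : (Multiset.toFinsupp (L : Multiset ℕ+)).degree = L.length := by
    have := Finsupp.card_toMultiset (Multiset.toFinsupp (L : Multiset ℕ+))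
    rw [Multiset.toFinsupp_toMultiset, Multiset.coe_card] at this
    rw [this]; rfl
  rw [h, rotation, Module.Basis.constr_basis, hd, MvPolynomial.coe_basisMonomials]

/-- The sum of the subspaces of `α`-length congruent to `l` modulo `k`. -/
def residueSpace (k l : ℕ) : Submodule ℂ Fock :=
  ⨆ (d : ℕ) (_ : d ≡ l [MOD k]), alphaLength d

end MZVertex

end

/-!
# Mathieu-Zhao subspaces of the rank one Heisenberg vertex algebra

The `α`-length is the degree of a polynomial in `ℂ[x₁, x₂, …]`, so `residueSpace k l` consists of
the polynomials supported in degrees congruent to `l` modulo `k`. The rotation acts diagonally on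
monomials through powers of a primitive `k`-th root of unity, which gives its order, its eigenspaces
and the direct sum decomposition.

The Mathieu-Zhao property comes from one leading term computation. In the mode `v(-1)` of
`v = α(-m₁) ⋯ α(-m_d) 1`, the product `α(-m₁) ⋯ α(-m_d)` occurs with coefficient `1`; every other
term with a nonzero coefficient contains some `α(j)` with `j ≥ 0`, and such a factor does not raise
the length. Hence `v(-1) w` and the polynomial product `v * w` agree up to vectors of length smaller
than the sum of the lengths (`mode_neg_one_sub_mem`), and `v(-1)ᵗ 1` agrees with `vᵗ` in this sense
(`iterMode_replicate_sub_mem`). Let `M` be a sum of residue spaces with residues `1 ≤ l ≤ k - 1`.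
The polynomial ring is a domain, so for `v ≠ 0` and `t` divisible by `k` the vector `v(-1)ᵗ 1` has a
nonzero component of length divisible by `k`, and does not lie in `M`. Thus the radical of `M` is
zero (`radical_eq`), and so is the strong radical, which contains `0` and lies in the radical
because `1(-1)` is the identity.

The same computation shows that `(x₁^(k-l))(-1) x₁^l ∉ M`, so that a nonzero `M` is not an ideal.
The spaces `residueSpace k 1`, `k ≥ 2`, are pairwise distinct: `x₁^(k+1)` lies in
`residueSpace k' 1` only if `k'` divides `k`.
-/

open MvPolynomial

namespace MZVertex

/-! ### The grading by length in terms of supports -/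

theorem iSup_restrictSupport {ι : Sort*} (s : ι → Set (ℕ+ →₀ ℕ)) :
    ⨆ i, restrictSupport ℂ (s i) = restrictSupport ℂ (⋃ i, s i) := by
  simp only [restrictSupport_eq_span, Set.image_iUnion, Submodule.span_iUnion]

theorem length_toList_toMultiset (d : ℕ+ →₀ ℕ) :
    (Finsupp.toMultiset d).toList.length = d.degree := by
  rw [Multiset.length_toList, Finsupp.card_toMultiset]; rfl

theorem alphaVec_eq_monomial (L : List ℕ+) :
    alphaVec L = monomial (Multiset.toFinsupp (L : Multiset ℕ+)) 1 := by
  rw [monomial_eq_alphaVec, alphaVec_eq, alphaVec_eq, ← Multiset.prod_coe, ← Multiset.map_coe,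
    ← Multiset.prod_coe, ← Multiset.map_coe, Multiset.coe_toList, Multiset.toFinsupp_toMultiset]

theorem degree_toFinsupp_coe (L : List ℕ+) :
    (Multiset.toFinsupp (L : Multiset ℕ+)).degree = L.length := by
  rw [← length_toList_toMultiset, Multiset.toFinsupp_toMultiset, Multiset.length_toList,
    Multiset.coe_card]

theorem alphaLength_eq (n : ℕ) : alphaLength n = restrictSupport ℂ {d | d.degree = n} := by
  rw [restrictSupport_eq_span, alphaLength]
  congr 1
  ext v
  constructor
  · rintro ⟨L, rfl, rfl⟩
    exact ⟨_, degree_toFinsupp_coe L, (alphaVec_eq_monomial L).symm⟩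
  · rintro ⟨d, rfl, rfl⟩
    exact ⟨_, length_toList_toMultiset d, monomial_eq_alphaVec d⟩

theorem residueSpace_eq (k l : ℕ) :
    residueSpace k l = restrictSupport ℂ {d | d.degree ≡ l [MOD k]} := by
  simp only [residueSpace, alphaLength_eq, iSup_restrictSupport]
  congr 1
  ext d
  simp

theorem iSup_residueSpace_eq (k : ℕ) (S : Finset ℕ) :
    ⨆ l ∈ S, residueSpace k l = restrictSupport ℂ {d | ∃ l ∈ S, d.degree ≡ l [MOD k]} := by
  simp only [residueSpace_eq, iSup_restrictSupport]
  congr 1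
  ext d
  simp

/-- No sum of residue spaces with residues `1 ≤ l ≤ k - 1` meets the lengths divisible by `k`. -/
theorem coeff_eq_zero_of_mem {k : ℕ} (hk : 1 < k) {S : Finset ℕ} (hS : S ⊆ Finset.Icc 1 (k - 1))
    {v : Fock} (hv : v ∈ ⨆ l ∈ S, residueSpace k l) {d : ℕ+ →₀ ℕ} (hd : k ∣ d.degree) :
    coeff d v = 0 := by
  rw [iSup_residueSpace_eq, mem_restrictSupport_iff] at hv
  by_contra h
  obtain ⟨l, hl, hdl⟩ := hv (mem_support_iff.mpr h)
  have := Finset.mem_Icc.mp (hS hl)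
  have hkl : k ∣ l := (hdl.dvd_iff dvd_rfl).mp hd
  have := Nat.le_of_dvd (by omega) hkl
  omega

theorem X_pow_mem_residueSpace (k n l : ℕ) :
    (X 1 ^ n : Fock) ∈ residueSpace k l ↔ n ≡ l [MOD k] := by
  rw [residueSpace_eq, X_pow_eq_monomial, monomial_mem_restrictSupport]
  simp [Finsupp.degree_single]

/-! ### The rotation -/

theorem rotation_monomial (k : ℕ) (d : ℕ+ →₀ ℕ) (c : ℂ) : rotation k (monomial d c) =
    Complex.exp (2 * Real.pi * Complex.I / k) ^ d.degree • monomial d c := by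
  have h : monomial d c = c • MvPolynomial.basisMonomials ℕ+ ℂ d := by
    rw [coe_basisMonomials, smul_monomial, smul_eq_mul, mul_one]
  rw [h, map_smul, rotation, Module.Basis.constr_basis, coe_basisMonomials, smul_comm]

theorem coeff_rotation (k : ℕ) (d : ℕ+ →₀ ℕ) (v : Fock) : coeff d (rotation k v) =
    Complex.exp (2 * Real.pi * Complex.I / k) ^ d.degree * coeff d v := by
  induction v using MvPolynomial.induction_on' with
  | monomial e c =>
    rw [rotation_monomial, coeff_smul, coeff_monomial]
    split_ifs with h
    · rw [h, smul_eq_mul]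
    · simp
  | add u v hu hv => rw [map_add, coeff_add, coeff_add, mul_add, hu, hv]

theorem coeff_rotation_pow (k n : ℕ) (d : ℕ+ →₀ ℕ) (v : Fock) : coeff d ((rotation k ^ n) v) =
    (Complex.exp (2 * Real.pi * Complex.I / k) ^ d.degree) ^ n * coeff d v := by
  induction n generalizing v with
  | zero => simp
  | succ n ih =>
    rw [pow_succ, Module.End.mul_apply, ih, coeff_rotation, ← mul_assoc, ← pow_succ]

theorem isPrimitiveRoot_exp_div {k : ℕ} (hk : 1 < k) :
    IsPrimitiveRoot (Complex.exp (2 * Real.pi * Complex.I / k)) k :=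
  Complex.isPrimitiveRoot_exp k (by omega)

theorem exp_mul_div (k l : ℕ) : Complex.exp (2 * Real.pi * Complex.I * l / k) =
    Complex.exp (2 * Real.pi * Complex.I / k) ^ l := by
  rw [← Complex.exp_nat_mul]
  congr 1
  ring

theorem orderOf_rotation {k : ℕ} (hk : 1 < k) : orderOf (rotation k) = k := by
  have hζ := isPrimitiveRoot_exp_div hk
  refine Nat.dvd_antisymm (orderOf_dvd_of_pow_eq_one ?_) (hζ.dvd_of_pow_eq_one _ ?_)
  · refine LinearMap.ext fun v => MvPolynomial.ext _ _ fun d => ?_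
    rw [coeff_rotation_pow, pow_right_comm, hζ.pow_eq_one, one_pow, one_mul, Module.End.one_apply]
  · have h := coeff_rotation_pow k (orderOf (rotation k)) (Finsupp.single 1 1) (X 1)
    rw [pow_orderOf_eq_one, Module.End.one_apply, coeff_X_same, mul_one, Finsupp.degree_single,
      pow_one] at h
    exact h.symm

theorem eigenspace_rotation {k : ℕ} (hk : 1 < k) (l : ℕ) :
    Module.End.eigenspace (rotation k) (Complex.exp (2 * Real.pi * Complex.I * l / k)) =
      residueSpace k l := by
  have hζ := isPrimitiveRoot_exp_div hk
  ext v
  rw [Module.End.mem_eigenspace_iff, exp_mul_div, residueSpace_eq, mem_restrictSupport_iff,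
    MvPolynomial.ext_iff]
  refine forall_congr' fun d => ?_
  rw [coeff_rotation, coeff_smul, smul_eq_mul, mul_eq_mul_right_iff, Finset.mem_coe,
    mem_support_iff, (hζ.isOfFinOrder (by omega)).pow_eq_pow_iff_modEq, ← hζ.eq_orderOf,
    Set.mem_ofPred_eq]
  tauto

theorem isInternal_residueSpace {k : ℕ} (hk : 1 < k) :
    DirectSum.IsInternal (fun l : Fin k => residueSpace k l) := by
  have hζ := isPrimitiveRoot_exp_div hk
  rw [DirectSum.isInternal_submodule_iff_iSupIndep_and_iSup_eq_top]
  constructor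
  · simp only [← eigenspace_rotation hk]
    refine (Module.End.eigenspaces_iSupIndep (rotation k)).comp (f := fun l : Fin k =>
      Complex.exp (2 * Real.pi * Complex.I * (l : ℕ) / k)) fun a b hab => ?_
    simp only [exp_mul_div] at hab
    exact Fin.ext (hζ.pow_inj a.2 b.2 hab)
  · simp only [residueSpace_eq, iSup_restrictSupport]
    rw [← restrictSupport_univ]
    congr 1
    refine Set.eq_univ_of_forall fun d => Set.mem_iUnion.mpr
      ⟨⟨d.degree % k, Nat.mod_lt _ (by omega)⟩, ?_⟩
    exact (Nat.mod_modEq _ _).symm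

/-! ### The filtration by length -/

/-- The polynomials of degree less than `n`. The strict bound makes the zero space a member of
the filtration, so that "leading terms agree" needs no truncated subtraction. -/
noncomputable def lengthLT (n : ℕ) : Submodule ℂ Fock := restrictSupport ℂ {d | d.degree < n}

theorem lengthLT_mono {m n : ℕ} (h : m ≤ n) : lengthLT m ≤ lengthLT n :=
  restrictSupport_mono ℂ fun _ (hd : _ < m) => hd.trans_le h

theorem mul_mem_lengthLT {m n : ℕ} {v w : Fock} (hv : v ∈ lengthLT (m + 1))
    (hw : w ∈ lengthLT n) : v * w ∈ lengthLT (m + n) := by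
  have h := Submodule.mul_mem_mul hv hw
  rw [lengthLT, lengthLT, ← restrictSupport_add] at h
  refine restrictSupport_mono ℂ ?_ h
  rintro _ ⟨a, ha, b, hb, rfl⟩
  simp only [Set.mem_ofPred_eq, map_add] at ha hb ⊢
  omega

theorem pow_mem_lengthLT {m : ℕ} {v : Fock} (hv : v ∈ lengthLT (m + 1)) (t : ℕ) :
    v ^ t ∈ lengthLT (m * t + 1) := by
  induction t with
  | zero =>
    rw [pow_zero, lengthLT, ← C_1, ← monomial_zero', monomial_mem_restrictSupport]
    simp
  | succ t ih =>
    rw [pow_succ', mul_add_one, add_comm (m * t), add_assoc]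
    exact mul_mem_lengthLT hv ih

theorem pderiv_mem_lengthLT (i : ℕ+) {n : ℕ} {w : Fock} (hw : w ∈ lengthLT n) :
    pderiv i w ∈ lengthLT n := by
  suffices lengthLT n ≤ (lengthLT n).comap (pderiv (R := ℂ) i).toLinearMap from this hw
  conv_lhs => rw [lengthLT, restrictSupport_eq_span]
  rw [Submodule.span_le]
  rintro _ ⟨d, hd, rfl⟩
  have hd' : d.degree < n := hd
  change pderiv i (monomial d 1) ∈ lengthLT n
  rw [pderiv_monomial, lengthLT, monomial_mem_restrictSupport]
  exact Or.inl ((Finsupp.degree_mono tsub_le_self).trans_lt hd')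

theorem alpha_mem_lengthLT_of_nonneg {j : ℤ} (hj : 0 ≤ j) {n : ℕ} {w : Fock}
    (hw : w ∈ lengthLT n) : alpha j w ∈ lengthLT n := by
  rcases int_cases j with ⟨m, rfl⟩ | rfl | ⟨m, rfl⟩
  · have := m.pos
    omega
  · simp [alpha_zero]
  · rw [alpha_pos]
    exact Submodule.smul_mem _ _ (pderiv_mem_lengthLT m hw)

theorem alpha_mem_lengthLT (j : ℤ) {n : ℕ} {w : Fock} (hw : w ∈ lengthLT n) :
    alpha j w ∈ lengthLT (n + 1) := by
  rcases lt_or_ge j 0 with hj | hj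
  · obtain ⟨m, rfl⟩ : ∃ m : ℕ+, j = -(m : ℤ) := by
      rcases int_cases j with h | h | ⟨m, h⟩
      · exact h
      · omega
      · have := m.pos
        omega
    rw [alpha_neg, add_comm]
    refine mul_mem_lengthLT ?_ hw
    rw [lengthLT, X, monomial_mem_restrictSupport]
    simp [Finsupp.degree_single]
  · exact lengthLT_mono n.le_succ (alpha_mem_lengthLT_of_nonneg hj hw)

/-- Only the factors `α(j)` with `j < 0` raise the length. -/
theorem normalOrd_mem_lengthLT (js : List ℤ) {n : ℕ} {w : Fock} (hw : w ∈ lengthLT n) :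
    normalOrd js w ∈ lengthLT (n + (js.filter (· < 0)).length) := by
  have hneg : ∀ (l : List ℤ) (u : Fock), u ∈ lengthLT n →
      (l.map alpha).prod u ∈ lengthLT (n + l.length) := by
    intro l u hu
    induction l with
    | nil => simpa using hu
    | cons a l ih =>
      rw [List.map_cons, List.prod_cons, Module.End.mul_apply, List.length_cons, ← add_assoc]
      exact alpha_mem_lengthLT a ih
  have hnonneg : ∀ l : List ℤ, (∀ a ∈ l, 0 ≤ a) → (l.map alpha).prod w ∈ lengthLT n := by
    intro l hl
    induction l with
    | nil => simpa using hw
    | cons a l ih =>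
      rw [List.map_cons, List.prod_cons, Module.End.mul_apply]
      exact alpha_mem_lengthLT_of_nonneg (hl a List.mem_cons_self)
        (ih fun b hb => hl b (List.mem_cons_of_mem _ hb))
  exact hneg _ _ (hnonneg _ fun a ha => by simpa using (List.mem_filter.mp ha).2)

/-! ### The leading term of the product `v(-1) w` -/

/-- With `fieldCoeff_eq_zero`: the divided derivative `(1/(m-1)!) (d/dz)^(m-1) α(z)` has creation
part `∑ c_j α(j) z^(-j-m)` over `j ≤ -m`, starting with `α(-m)`. -/
theorem fieldCoeff_neg_self (m : ℕ+) : fieldCoeff m (-(m : ℤ)) = 1 := by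
  have h : -(-(m : ℤ)) - 1 = (m.natPred : ℤ) := by
    have := m.natPred_add_one
    omega
  rw [fieldCoeff, h, Ring.choose_natCast, Nat.choose_self]
  simp

theorem fieldCoeff_eq_zero {m : ℕ+} {j : ℤ} (hj : j < 0) (hjm : -(m : ℤ) < j) :
    fieldCoeff m j = 0 := by
  obtain ⟨a, ha⟩ : ∃ a : ℕ, -j - 1 = a := ⟨(-j - 1).toNat, by omega⟩
  have := m.natPred_add_one
  rw [fieldCoeff, ha, Ring.choose_natCast, Nat.choose_eq_zero_of_lt (by omega)]
  simp

theorem normalOrd_ofFn_neg (L : List ℕ+) (w : Fock) :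
    normalOrd (List.ofFn fun i => -(L.get i : ℤ)) w = alphaVec L * w := by
  have hL : (List.ofFn fun i => -(L.get i : ℤ)) = L.map fun m : ℕ+ => -(m : ℤ) := by
    conv_rhs => rw [← List.ofFn_get L, List.map_ofFn]
    rfl
  have h1 : (L.map fun m : ℕ+ => -(m : ℤ)).filter (· < 0) = L.map fun m : ℕ+ => -(m : ℤ) := by
    rw [List.filter_eq_self]
    simp
  have h2 : (L.map fun m : ℕ+ => -(m : ℤ)).filter (0 ≤ ·) = [] := by
    rw [List.filter_eq_nil_iff]
    simp
  rw [normalOrd, hL, h1, h2, alphaVec_eq]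
  clear hL h1 h2
  simp only [List.map_nil, List.prod_nil, mul_one]
  induction L with
  | nil => simp
  | cons a L ih =>
    simp only [List.map_cons, List.prod_cons, Module.End.mul_apply, ih, alpha_neg, mul_assoc]

/-- Of all terms of the mode `-1`, only `α(-m₁) ⋯ α(-m_d)` raises the length by `d`. -/
theorem monoMode_neg_one_sub_mem (L : List ℕ+) {n : ℕ} {w : Fock} (hw : w ∈ lengthLT (n + 1)) :
    monoMode L (-1) w - alphaVec L * w ∈ lengthLT (L.length + n) := by
  change monoModeFun L (-1) w - _ ∈ _
  let j₀ : Fin L.length → ℤ := fun i => -(L.get i : ℤ)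
  have hj₀ : {j₀} ⊆ {j : Fin L.length → ℤ | ∑ i, (j i + (L.get i : ℤ)) = -1 + 1} := by
    rw [Set.singleton_subset_iff, Set.mem_ofPred_eq]
    simp [j₀]
  rw [monoModeFun, ← finsum_mem_add_sdiff' hj₀ (monoMode_finite L (-1) w), finsum_mem_singleton,
    Finset.prod_congr rfl fun i _ => fieldCoeff_neg_self (L.get i), Finset.prod_const_one,
    one_smul, normalOrd_ofFn_neg, add_sub_cancel_left]
  refine finsum_mem_induction (· ∈ lengthLT (L.length + n)) (Submodule.zero_mem _)
    (fun _ _ hx hy => Submodule.add_mem _ hx hy) ?_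
  rintro j ⟨hj, hne⟩
  by_cases hneg : ∃ i, 0 ≤ j i
  · -- A factor `α(jᵢ)` with `jᵢ ≥ 0` does not raise the length.
    obtain ⟨i, hi⟩ := hneg
    refine Submodule.smul_mem _ _ (lengthLT_mono ?_ (normalOrd_mem_lengthLT _ hw))
    have : ((List.ofFn j).filter (· < 0)).length < (List.ofFn j).length := by
      refine List.length_filter_lt_length_iff_exists.mpr
        ⟨j i, (List.mem_ofFn' _ _).mpr ⟨i, rfl⟩, ?_⟩
      simpa using hi
    rw [List.length_ofFn] at this
    omega
  · push Not at hneg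
    -- If all `jᵢ < 0`, a nonzero coefficient forces `jᵢ ≤ -mᵢ`, and then `∑ (jᵢ + mᵢ) = 0`
    -- forces `j = j₀`.
    obtain ⟨i, hi⟩ : ∃ i, -(L.get i : ℤ) < j i := by
      by_contra! h
      refine hne (funext fun i => ?_)
      have hj' : ∑ i, (j i + (L.get i : ℤ)) = 0 := hj
      rw [Finset.sum_eq_zero_iff_of_nonpos fun i _ => by have := h i; omega] at hj'
      have := hj' i (Finset.mem_univ i)
      simp only [j₀]
      omega
    rw [Finset.prod_eq_zero (Finset.mem_univ i) (fieldCoeff_eq_zero (hneg i) hi), zero_smul]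
    exact Submodule.zero_mem _

theorem mode_add (v v' : Fock) (n : ℤ) :
    mode fockY (v + v') n = mode fockY v n + mode fockY v' n := by
  simp [mode]

theorem mode_smul (c : ℂ) (v : Fock) (n : ℤ) : mode fockY (c • v) n = c • mode fockY v n := by
  simp [mode]

/-- The leading term of `v(-1) w` is that of the product of the polynomials `v` and `w`. -/
theorem mode_neg_one_sub_mem {m n : ℕ} {v w : Fock} (hv : v ∈ lengthLT (m + 1))
    (hw : w ∈ lengthLT (n + 1)) : mode fockY v (-1) w - v * w ∈ lengthLT (m + n) := by
  rw [lengthLT, restrictSupport_eq_span] at hv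
  induction hv using Submodule.span_induction with
  | mem v hv =>
    obtain ⟨d, hd, rfl⟩ := hv
    have hd' : d.degree < m + 1 := hd
    simp only
    rw [monomial_eq_alphaVec, mode_alphaVec]
    refine lengthLT_mono ?_ (monoMode_neg_one_sub_mem _ hw)
    rw [length_toList_toMultiset]
    omega
  | zero => simp [mode]
  | add v v' _ _ h h' =>
    rw [mode_add, LinearMap.add_apply, add_mul, add_sub_add_comm]
    exact Submodule.add_mem _ h h'
  | smul c v _ h =>
    rw [mode_smul, LinearMap.smul_apply, smul_mul_assoc, ← smul_sub]
    exact Submodule.smul_mem _ _ h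

theorem iterMode_replicate_sub_mem {m : ℕ} {v : Fock} (hv : v ∈ lengthLT (m + 1)) (t : ℕ) :
    iterMode fockY 1 v (List.replicate t (-1)) - v ^ t ∈ lengthLT (m * t) := by
  induction t with
  | zero => simp [iterMode]
  | succ t ih =>
    have hstep : iterMode fockY 1 v (List.replicate (t + 1) (-1)) =
        mode fockY v (-1) (iterMode fockY 1 v (List.replicate t (-1))) := by
      simp [iterMode, List.replicate_succ]
    rw [hstep]
    set u := iterMode fockY 1 v (List.replicate t (-1))
    have hu : u ∈ lengthLT (m * t + 1) := by
      rw [← sub_add_cancel u (v ^ t)]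
      exact Submodule.add_mem _ (lengthLT_mono (Nat.le_succ _) ih) (pow_mem_lengthLT hv t)
    have h := Submodule.add_mem _ (mode_neg_one_sub_mem hv hu) (mul_mem_lengthLT hv ih)
    rw [mul_add_one, add_comm (m * t)]
    convert h using 1
    ring

theorem coeff_eq_zero_of_mem_lengthLT {n : ℕ} {v : Fock} (hv : v ∈ lengthLT n) {d : ℕ+ →₀ ℕ}
    (hd : n ≤ d.degree) : coeff d v = 0 := by
  by_contra h
  exact (hv (mem_support_iff.mpr h)).not_ge hd

theorem mem_lengthLT_totalDegree (v : Fock) : v ∈ lengthLT (v.totalDegree + 1) := fun _ hd =>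
  Nat.lt_succ_of_le (le_totalDegree hd)

/-! ### Radicals and ideals -/

theorem totalDegree_pow_eq {v : Fock} (hv : v ≠ 0) (t : ℕ) :
    (v ^ t).totalDegree = v.totalDegree * t := by
  induction t with
  | zero => simp
  | succ t ih =>
    rw [pow_succ, totalDegree_mul_of_isDomain (pow_ne_zero t hv) hv, ih, mul_add_one]

/-- The identity `1(-1) = id`, which puts the left strong radical inside the radical. -/
theorem mode_one (w : Fock) : mode fockY 1 (-1) w = w := by
  have h : (1 : Fock) = alphaVec [] := by simp [alphaVec]
  rw [h, mode_alphaVec]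
  change monoModeFun [] (-1) w = w
  have hset : {j : Fin ([] : List ℕ+).length → ℤ |
      ∑ i, (j i + (([] : List ℕ+).get i : ℤ)) = -1 + 1} = {Fin.elim0} := by
    ext j
    simp only [List.length_nil, Set.mem_ofPred_eq, Set.mem_singleton_iff]
    simp [eq_iff_true_of_subsingleton (α := Fin 0 → ℤ)]
  rw [monoModeFun, hset, finsum_mem_singleton]
  simp [normalOrd]

/-- The radical vanishes: for `v ≠ 0` the vector `v(-1)ᵗ 1` has the same leading term as `vᵗ`, and
if `k ∣ t`, its length is divisible by `k`. -/
theorem radical_eq {k : ℕ} (hk : 1 < k) {S : Finset ℕ} (hS : S ⊆ Finset.Icc 1 (k - 1)) :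
    radical fockY (1 : Fock) (⨆ l ∈ S, residueSpace k l) = {0} := by
  refine Set.Subset.antisymm ?_ ?_
  · rintro v ⟨m, hm, h⟩
    by_contra hv
    have hv0 : v ≠ 0 := hv
    -- Length `k * m` is both at least `m` and divisible by `k`.
    have hmem := h (List.replicate (k * m) (-1)) (by
      rw [List.length_replicate]; exact Nat.le_mul_of_pos_left m (by omega))
    have hlead := iterMode_replicate_sub_mem (mem_lengthLT_totalDegree v) (k * m)
    obtain ⟨d, hd, hdeg⟩ : ∃ d ∈ (v ^ (k * m)).support, d.degree = v.totalDegree * (k * m) := by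
      rw [← totalDegree_pow_eq hv0]
      obtain ⟨d, hd, h⟩ := Finset.exists_mem_eq_sup _
        (support_nonempty.mpr (pow_ne_zero (k * m) hv0)) fun s : ℕ+ →₀ ℕ => s.degree
      exact ⟨d, hd, h.symm⟩
    have h0 := coeff_eq_zero_of_mem_lengthLT hlead hdeg.ge
    rw [coeff_sub, coeff_eq_zero_of_mem hk hS hmem
      (hdeg ▸ dvd_mul_of_dvd_right (dvd_mul_right k m) _), zero_sub, neg_eq_zero] at h0
    exact mem_support_iff.mp hd h0
  · rintro _ rfl
    refine ⟨1, le_rfl, fun ns hns => ?_⟩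
    obtain ⟨n, ns, rfl⟩ := List.exists_cons_of_length_pos hns
    simp [iterMode, mode]

theorem isMathieuZhao_of_radical_eq {M : Submodule ℂ Fock}
    (hM : radical fockY (1 : Fock) M = {0}) : IsMathieuZhao fockY (1 : Fock) M := by
  refine Set.Subset.antisymm ?_ ?_
  · rw [hM]
    rintro _ rfl
    have h : ∀ ns : List ℤ, 1 ≤ ns.length → iterMode fockY (1 : Fock) 0 ns = 0 := by
      intro ns hns
      obtain ⟨n, ns, rfl⟩ := List.exists_cons_of_length_pos hns
      simp [iterMode, mode]
    refine ⟨⟨1, le_rfl, fun ns hns b s => ?_⟩, ⟨1, le_rfl, fun ns hns w n => ?_⟩⟩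
    · rw [h ns hns, map_zero]
      exact M.zero_mem
    · rw [h ns hns]
      simp [mode]
  · rintro v ⟨⟨m, hm, h⟩, -⟩
    refine ⟨m, hm, fun ns hns => ?_⟩
    rw [← mode_one (iterMode fockY 1 v ns)]
    exact h ns hns 1 (-1)

/-- The vector `x₁^l` lies in the subspace for `l ∈ S`, while `(x₁^(k-l))(-1) x₁^l` has leading
term `x₁^k`, of length divisible by `k`. -/
theorem not_isVertexIdeal {k : ℕ} (hk : 1 < k) {S : Finset ℕ} (hS : S ⊆ Finset.Icc 1 (k - 1))
    (hne : S.Nonempty) : ¬ IsVertexIdeal fockY (⨆ l ∈ S, residueSpace k l) := by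
  intro h
  obtain ⟨l, hl⟩ := hne
  have hlk := Finset.mem_Icc.mp (hS hl)
  have hX (n : ℕ) : (X 1 ^ n : Fock) ∈ lengthLT (n + 1) := by
    simpa using pow_mem_lengthLT (m := 1) (v := X 1)
      (by simpa using mem_lengthLT_totalDegree (X 1 : Fock)) n
  have hmem : (X 1 ^ l : Fock) ∈ ⨆ l ∈ S, residueSpace k l :=
    le_iSup₂ (f := fun l _ => residueSpace k l) l hl ((X_pow_mem_residueSpace k l l).mpr rfl)
  have hlead := mode_neg_one_sub_mem (hX (k - l)) (hX l)
  have hkl : k - l + l = k := by omega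
  have hdeg : (Finsupp.single (1 : ℕ+) k).degree = k := Finsupp.degree_single _ _
  rw [← pow_add, hkl] at hlead
  have h0 := coeff_eq_zero_of_mem_lengthLT hlead hdeg.ge
  rw [coeff_sub, coeff_eq_zero_of_mem hk hS (h _ _ hmem _).2 hdeg.symm.dvd, X_pow_eq_monomial,
    coeff_monomial, if_pos rfl] at h0
  norm_num at h0

end MZVertex

theorem corollary47 :
    (∀ k : ℕ, 1 < k →
      orderOf (MZVertex.rotation k) = k ∧
      (∀ l : Fin k, Module.End.eigenspace (MZVertex.rotation k)
        (Complex.exp (2 * Real.pi * Complex.I * (l : ℕ) / k)) = MZVertex.residueSpace k l) ∧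
      DirectSum.IsInternal (fun l : Fin k => MZVertex.residueSpace k l) ∧
      ∀ S : Finset ℕ, S ⊆ Finset.Icc 1 (k - 1) →
        MZVertex.IsMathieuZhao MZVertex.fockY (1 : MZVertex.Fock)
          (⨆ l ∈ S, MZVertex.residueSpace k l) ∧
        (S.Nonempty →
          ¬ MZVertex.IsVertexIdeal MZVertex.fockY (⨆ l ∈ S, MZVertex.residueSpace k l))) ∧
    Set.Infinite {M : Submodule ℂ MZVertex.Fock |
      (∃ k : ℕ, 1 < k ∧ ∃ S : Finset ℕ, S ⊆ Finset.Icc 1 (k - 1) ∧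
        M = ⨆ l ∈ S, MZVertex.residueSpace k l) ∧
      MZVertex.IsMathieuZhao MZVertex.fockY (1 : MZVertex.Fock) M ∧
      ¬ MZVertex.IsVertexIdeal MZVertex.fockY M} := by
  refine ⟨fun k hk => ⟨MZVertex.orderOf_rotation hk,
    fun l => MZVertex.eigenspace_rotation hk l, MZVertex.isInternal_residueSpace hk,
    fun S hS => ⟨MZVertex.isMathieuZhao_of_radical_eq (MZVertex.radical_eq hk hS),
      MZVertex.not_isVertexIdeal hk hS⟩⟩, ?_⟩
  refine Set.infinite_of_injective_forall_mem
    (f := fun n : ℕ => ⨆ l ∈ ({1} : Finset ℕ), MZVertex.residueSpace (n + 2) l) ?_ fun n => ?_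
  · -- `x₁^(k+1)` has length `≡ 1` modulo `k`; it lies in the space for `k'` only if `k' ∣ k`.
    have hdvd : ∀ a b : ℕ, MZVertex.residueSpace (a + 2) 1 = MZVertex.residueSpace (b + 2) 1 →
        b + 2 ∣ a + 2 := by
      intro a b hab
      have h := (MZVertex.X_pow_mem_residueSpace (a + 2) (a + 2 + 1) 1).mpr (by
        simp [Nat.ModEq])
      rw [hab, MZVertex.X_pow_mem_residueSpace] at h
      exact (Nat.modEq_iff_dvd' (by omega)).mp h.symm
    intro a b hab
    simp only [Finset.mem_singleton, iSup_iSup_eq_left] at hab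
    have := Nat.dvd_antisymm (hdvd a b hab) (hdvd b a hab.symm)
    omega
  · have hk : 1 < n + 2 := by omega
    have hS : ({1} : Finset ℕ) ⊆ Finset.Icc 1 (n + 2 - 1) := by simp
    exact ⟨⟨n + 2, hk, {1}, hS, rfl⟩,
      MZVertex.isMathieuZhao_of_radical_eq (MZVertex.radical_eq hk hS),
      MZVertex.not_isVertexIdeal hk hS (Finset.singleton_nonempty 1)⟩
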